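/- All graphs are finite, simple, undirected and have at least one vertex. A $k$-star colouring of a graph $G$ is a proper colouring $f:V(G)\to\{0,1,\dots,k-1\}$ such that, for every two distinct colours $i,j$, each connected component of the subgraph of $G$ induced by $f^{-1}(i)\cup f^{-1}(j)$ is a star $K_{1,m}$ for some $m\ge 0$; $G$ is $k$-star colourable if it has such a colouring. The diamond is the graph obtained from $K_4$ by deleting one edge. A $P_4$-decomposition of $G$ is a collection of subgraphs of $G$, each isomorphic to the path $P_4$ on four vertices, such that each edge of $G$ belongs to exactly one of them. An asteroidal triple of $G$ is a set of three distinct, pairwise non-adjacent vertices such that any two of them are joined by a path in $G$ that contains neither the third vertex nor any neighbour of it. Let $p\ge 2$ be an integer and let $G$ be a $2p$-regular $(p+2)$-star colourable graph on $n$ vertices. Then: (i) $G$ is (diamond, $K_4$)-free; more precisely, $G$ contains neither the diamond nor $K_4$ as a (not necessarily induced) subgraph; (ii) the independence number satisfies $\alpha(G)>n/4$; (iii) the chromatic number satisfies $\chi(G)\le 3\log_2(p+2)$; (iv) $G$ admits a $P_4$-decomposition; (v) if $G$ contains no asteroidal triple, then $G$ is $3$-colourable. -/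

import Mathlib

namespace SimpleGraph

/-- A graph is a star `K_{1,m}` (for some `m ≥ 0`): for some centre `c`, its edges are exactly
the pairs consisting of `c` and another vertex. -/
def IsStar {V : Type*} (G : SimpleGraph V) : Prop :=
  ∃ c : V, G = starGraph c

/-- A proper colouring `f` is a star colouring if every bicoloured component, that is, every
connected component of the subgraph induced by the union of two colour classes, is a star. -/
def IsStarColoring {V : Type*} {G : SimpleGraph V} {k : ℕ} (f : G.Coloring (Fin k)) : Prop :=
  ∀ i j : Fin k, i ≠ j →
    ∀ C : (G.induce {v : V | f v = i ∨ f v = j}).ConnectedComponent, C.toSimpleGraph.IsStar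

/-- `G` is `k`-star colourable. -/
def StarColorable {V : Type*} (G : SimpleGraph V) (k : ℕ) : Prop :=
  ∃ f : G.Coloring (Fin k), IsStarColoring f

/-- The diamond: `K_4` minus the edge between the vertices `0` and `1`. -/
def diamondGraph : SimpleGraph (Fin 4) :=
  (completeGraph (Fin 4)).deleteEdges {s(0, 1)}

/-- `G` has an `H`-decomposition: there is a collection of subgraphs of `G`, each isomorphic
to `H`, such that every edge of `G` lies in exactly one of them. -/
def HasDecomposition {V W : Type*} (G : SimpleGraph V) (H : SimpleGraph W) : Prop :=
  ∃ D : Set G.Subgraph, (∀ S ∈ D, Nonempty (S.coe ≃g H)) ∧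
    ∀ e ∈ G.edgeSet, ∃! S : G.Subgraph, S ∈ D ∧ e ∈ S.edgeSet

/-- There is a path from `a` to `b` in `G` that avoids the closed neighbourhood of `c`. -/
def HasPathAvoiding {V : Type*} (G : SimpleGraph V) (a b c : V) : Prop :=
  ∃ P : G.Walk a b, P.IsPath ∧ ∀ v ∈ P.support, v ≠ c ∧ ¬ G.Adj c v

/-- `a, b, c` form an asteroidal triple: three distinct pairwise non-adjacent vertices such that
any two of them are joined by a path avoiding the closed neighbourhood of the third. -/
def IsAsteroidalTriple {V : Type*} (G : SimpleGraph V) (a b c : V) : Prop :=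
  (a ≠ b ∧ a ≠ c ∧ b ≠ c) ∧ (¬ G.Adj a b ∧ ¬ G.Adj a c ∧ ¬ G.Adj b c) ∧
    G.HasPathAvoiding a b c ∧ G.HasPathAvoiding a c b ∧ G.HasPathAvoiding b c a

end SimpleGraph

namespace SimpleGraph

variable {V : Type*} {G : SimpleGraph V}

lemma IsStar.not_adj_of_adj_of_adj {W : Type*} {H : SimpleGraph W} (hH : H.IsStar) {a b c d : W}
    (hab : H.Adj a b) (hbc : H.Adj b c) (hcd : H.Adj c d) (hac : a ≠ c) (hbd : b ≠ d) : False := by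
  obtain ⟨x, rfl⟩ := hH
  simp only [starGraph_adj] at hab hbc hcd
  grind

/-- A star colouring has no bicoloured path on four vertices. -/
lemma IsStarColoring.no_bicolored_path {k : ℕ} {f : G.Coloring (Fin k)} (hf : IsStarColoring f)
    {a b c d : V} (hab : G.Adj a b) (hbc : G.Adj b c) (hcd : G.Adj c d)
    (hac : a ≠ c) (hbd : b ≠ d) (fac : f a = f c) (fbd : f b = f d) : False := by
  set S : Set V := {v : V | f v = f a ∨ f v = f b} with hS
  have ha : a ∈ S := Or.inl rfl
  have hb : b ∈ S := Or.inr rfl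
  have hc : c ∈ S := Or.inl fac.symm
  have hd : d ∈ S := Or.inr fbd.symm
  have Hab : (G.induce S).Adj ⟨a, ha⟩ ⟨b, hb⟩ := hab
  have Hbc : (G.induce S).Adj ⟨b, hb⟩ ⟨c, hc⟩ := hbc
  have Hcd : (G.induce S).Adj ⟨c, hc⟩ ⟨d, hd⟩ := hcd
  let C := (G.induce S).connectedComponentMk ⟨a, ha⟩
  have Ca : (⟨a, ha⟩ : S) ∈ C := rfl
  have Cb : (⟨b, hb⟩ : S) ∈ C := ConnectedComponent.sound Hab.symm.reachable
  have Cc : (⟨c, hc⟩ : S) ∈ C :=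
    ConnectedComponent.sound (Hbc.symm.reachable.trans Hab.symm.reachable)
  have Cd : (⟨d, hd⟩ : S) ∈ C :=
    ConnectedComponent.sound (Hcd.symm.reachable.trans (Hbc.symm.reachable.trans
      Hab.symm.reachable))
  refine (hf (f a) (f b) (f.valid hab) C).not_adj_of_adj_of_adj
    (a := ⟨_, Ca⟩) (b := ⟨_, Cb⟩) (c := ⟨_, Cc⟩) (d := ⟨_, Cd⟩)
    ((C.toSimpleGraph_adj Ca Cb).2 Hab) ((C.toSimpleGraph_adj Cb Cc).2 Hbc)
    ((C.toSimpleGraph_adj Cc Cd).2 Hcd) ?_ ?_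
  · simpa [Subtype.ext_iff] using hac
  · simpa [Subtype.ext_iff] using hbd

/-- The colouring `f` comes with an in-colour `g`: exactly `p` neighbours of `v` have colour `g v`,
exactly one neighbour has any other given colour different from `f v`, and every edge `uv` is an
arc in exactly one direction, where `u → v` means `g v = f u`. -/
structure IsInColoring [Fintype V] [DecidableRel G.Adj] {k : ℕ} (f : G.Coloring (Fin k))
    (g : V → Fin k) (p : ℕ) : Prop where
  ne : ∀ v, g v ≠ f v
  arc : ∀ {u v}, G.Adj u v → (g v = f u ∧ g u ≠ f v) ∨ (g u = f v ∧ g v ≠ f u)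
  exists_out : ∀ v c, c ≠ f v → c ≠ g v → ∃ w, G.Adj v w ∧ f w = c ∧ g w = f v
  unique_out : ∀ {v w w'}, G.Adj v w → G.Adj v w' → f w = f w' → f w ≠ g v → w = w'
  card_in : ∀ v, {u ∈ G.neighborFinset v | f u = g v}.card = p

/-- A `2p`-regular graph with a `(p+2)`-star colouring has an in-colouring. -/
theorem IsStarColoring.exists_inColoring [Fintype V] [DecidableRel G.Adj] {p : ℕ} (hp : 2 ≤ p)
    (hreg : G.IsRegularOfDegree (2 * p)) {f : G.Coloring (Fin (p + 2))} (hf : IsStarColoring f) :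
    ∃ g : V → Fin (p + 2), IsInColoring f g p := by
  classical
  let U : V → V → Prop := fun v u => ∀ w, G.Adj v w → f w = f u → w = u
  let O : V → Finset V := fun v => {u ∈ G.neighborFinset v | U v u}
  have memO : ∀ v u, u ∈ O v ↔ G.Adj v u ∧ U v u := fun v u => by simp [O]
  have hU : ∀ u v, G.Adj u v → U u v ∨ U v u := by
    intro u v huv
    by_contra hcon
    simp only [U, not_or, not_forall] at hcon
    obtain ⟨⟨w, hw, fw, hwv⟩, ⟨x, hx, fx, hxu⟩⟩ := hcon
    exact hf.no_bicolored_path hw.symm huv hx hwv (Ne.symm hxu) fw fx.symm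
  have hinj : ∀ v, Set.InjOn f (O v) := by
    intro v a ha b hb hab
    exact ((memO v b).1 hb).2 a ((memO v a).1 ha).1 hab
  have himg : ∀ v, (O v).image f ⊆ Finset.univ.erase (f v) := by
    intro v c hc
    obtain ⟨u, hu, rfl⟩ := Finset.mem_image.1 hc
    simpa using (f.valid ((memO v u).1 hu).1).symm
  have hcardE : ∀ v, (Finset.univ.erase (f v)).card = p + 1 := by
    intro v; simp
  have hle : ∀ v, (O v).card ≤ p := by
    intro v
    by_contra hcon
    have hc : ((O v).image f).card = (O v).card := Finset.card_image_of_injOn (hinj v)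
    have heq : (O v).image f = Finset.univ.erase (f v) :=
      Finset.eq_of_subset_of_card_le (himg v) (by rw [hcardE, hc]; omega)
    have hsub : G.neighborFinset v ⊆ O v := by
      intro u hu
      rw [mem_neighborFinset] at hu
      have : f u ∈ (O v).image f := by rw [heq]; simpa using (f.valid hu).symm
      obtain ⟨w, hw, hwu⟩ := Finset.mem_image.1 this
      have := ((memO v w).1 hw).2 u hu hwu.symm
      rwa [this]
    have h1 := Finset.card_le_card hsub
    rw [card_neighborFinset_eq_degree, hreg v, ← hc, heq, hcardE] at h1
    omega
  have hdeg : ∀ v, ∑ u, (if G.Adj v u then 1 else 0) = 2 * p := by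
    intro v
    rw [← hreg v, ← card_neighborFinset_eq_degree, neighborFinset_eq_filter, Finset.card_filter]
  have hO : ∀ v, ∑ u, (if u ∈ O v then 1 else 0) = (O v).card := by
    intro v; simp
  have hpt : ∀ x ∈ (Finset.univ : Finset (V × V)), (if G.Adj x.1 x.2 then 1 else 0) ≤
      (if x.2 ∈ O x.1 then 1 else 0) + (if x.1 ∈ O x.2 then 1 else 0) := by
    rintro ⟨u, v⟩ -
    by_cases h : G.Adj u v
    · rcases hU u v h with h' | h'
      · have : v ∈ O u := (memO u v).2 ⟨h, h'⟩
        simp [this, h]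
      · have : u ∈ O v := (memO v u).2 ⟨h.symm, h'⟩
        simp [this, h]
    · simp [h]
  have hsumL : ∑ x : V × V, (if G.Adj x.1 x.2 then 1 else 0) = Fintype.card V * (2 * p) := by
    rw [Fintype.sum_prod_type]; simp only [hdeg]; simp
  have hsumR : ∑ x : V × V, ((if x.2 ∈ O x.1 then 1 else 0) + (if x.1 ∈ O x.2 then 1 else 0))
      = 2 * ∑ v, (O v).card := by
    rw [Finset.sum_add_distrib, Fintype.sum_prod_type, Fintype.sum_prod_type_right]
    simp only [hO]; ring
  have hsumO : ∑ v, (O v).card ≤ ∑ _v : V, p := Finset.sum_le_sum fun v _ => hle v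
  have hcst : ∑ _v : V, p = Fintype.card V * p := by simp
  have hineq := Finset.sum_le_sum hpt
  rw [hsumL, hsumR] at hineq
  have hOeq : ∀ v, (O v).card = p := by
    have : ∑ v, (O v).card = ∑ _v : V, p := by
      apply le_antisymm hsumO; rw [hcst]; nlinarith
    intro v
    exact (Finset.sum_eq_sum_iff_of_le fun v _ => hle v).1 this v (Finset.mem_univ v)
  have hpteq : ∀ u v, G.Adj u v → ¬ (v ∈ O u ∧ u ∈ O v) := by
    have heq : ∑ x : V × V, (if G.Adj x.1 x.2 then 1 else 0) = ∑ x : V × V,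
        ((if x.2 ∈ O x.1 then 1 else 0) + (if x.1 ∈ O x.2 then 1 else 0)) := by
      rw [hsumL, hsumR]; simp only [hOeq, hcst]; ring
    intro u v huv hcon
    have := (Finset.sum_eq_sum_iff_of_le hpt).1 heq (u, v) (Finset.mem_univ _)
    simp [huv, hcon.1, hcon.2] at this
  have hg : ∀ v, ∃ c, (Finset.univ.erase (f v)) \ (O v).image f = {c} := by
    intro v
    rw [← Finset.card_eq_one, Finset.card_sdiff_of_subset (himg v), hcardE,
      Finset.card_image_of_injOn (hinj v), hOeq]
    omega
  choose g hg using hg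
  have hgmem : ∀ v c, (c ≠ f v ∧ c ∉ (O v).image f) ↔ c = g v := by
    intro v c
    have := Finset.ext_iff.1 (hg v) c
    simpa using this
  have hne : ∀ v, g v ≠ f v := fun v => ((hgmem v (g v)).2 rfl).1
  have hout : ∀ v u, G.Adj v u → (u ∈ O v ↔ f u ≠ g v) := by
    intro v u hvu
    constructor
    · intro hu he
      exact ((hgmem v (g v)).2 rfl).2 (he ▸ Finset.mem_image_of_mem f hu)
    · intro hu
      have : f u ∈ (O v).image f := by
        by_contra hcon
        exact hu ((hgmem v (f u)).1 ⟨(f.valid hvu).symm, hcon⟩)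
      obtain ⟨w, hw, hwu⟩ := Finset.mem_image.1 this
      have := ((memO v w).1 hw).2 u hvu hwu.symm
      rwa [this]
  have harc : ∀ u v, G.Adj u v → (g v = f u ∧ g u ≠ f v) ∨ (g u = f v ∧ g v ≠ f u) := by
    intro u v huv
    have h1 := hout u v huv
    have h2 := hout v u huv.symm
    have h3 := hpteq u v huv
    have h4 : v ∈ O u ∨ u ∈ O v := (hU u v huv).imp (fun h => (memO u v).2 ⟨huv, h⟩)
      (fun h => (memO v u).2 ⟨huv.symm, h⟩)
    grind
  refine ⟨g, hne, fun {u v} => harc u v, ?_, ?_, ?_⟩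
  · intro v c hc hc'
    have : c ∈ (O v).image f := by
      by_contra hcon
      exact hc' ((hgmem v c).1 ⟨hc, hcon⟩)
    obtain ⟨w, hw, rfl⟩ := Finset.mem_image.1 this
    have hvw := ((memO v w).1 hw).1
    refine ⟨w, hvw, rfl, ?_⟩
    rcases harc v w hvw with h | h
    · exact h.1
    · exact absurd h.1.symm hc'
  · intro v w w' hw hw' hww hne'
    exact ((memO v w').1 ((hout v w' hw').2 (hww ▸ hne'))).2 w hw hww
  · intro v
    have h1 : {u ∈ G.neighborFinset v | f u = g v} = G.neighborFinset v \ O v := by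
      ext u
      simp only [Finset.mem_filter, mem_neighborFinset, Finset.mem_sdiff]
      constructor
      · rintro ⟨h, h'⟩; exact ⟨h, fun hc => (hout v u h).1 hc h'⟩
      · rintro ⟨h, h'⟩; exact ⟨h, by by_contra hc; exact h' ((hout v u h).2 hc)⟩
    rw [h1, Finset.card_sdiff_of_subset (Finset.filter_subset _ _), card_neighborFinset_eq_degree,
      hreg v, hOeq]
    omega

/-- No two triangles share an edge. -/
def TrianglesEdgeDisjoint (G : SimpleGraph V) : Prop :=
  ∀ ⦃a b c c' : V⦄, G.Adj a b → G.Adj a c → G.Adj b c → G.Adj a c' → G.Adj b c' → c = c'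

lemma TrianglesEdgeDisjoint.diamond_free (h : G.TrianglesEdgeDisjoint) : diamondGraph.Free G := by
  rintro ⟨φ⟩
  have hadj : ∀ i j : Fin 4, i ≠ j → s(i, j) ≠ s(0, 1) → G.Adj (φ i) (φ j) := by
    intro i j hij hs
    apply φ.toHom.map_adj
    simp only [diamondGraph, deleteEdges_adj, Set.mem_singleton_iff]
    exact ⟨hij, hs⟩
  have := h (hadj 2 3 (by decide) (by decide)) (hadj 2 0 (by decide) (by decide))
    (hadj 3 0 (by decide) (by decide)) (hadj 2 1 (by decide) (by decide))
    (hadj 3 1 (by decide) (by decide))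
  exact absurd (φ.injective this) (by decide)

lemma diamond_isContained_completeGraph : diamondGraph ⊑ completeGraph (Fin 4) :=
  IsContained.of_le (deleteEdges_le _)

lemma HasPathAvoiding.of_walk {a b c : V} (P : G.Walk a b)
    (hP : ∀ v ∈ P.support, v ≠ c ∧ ¬ G.Adj c v) : G.HasPathAvoiding a b c := by
  classical
  exact ⟨P.bypass, P.bypass_isPath, fun v hv => hP v (P.support_bypass_subset_support hv)⟩

section InColoring

variable [Fintype V] [DecidableRel G.Adj] {p : ℕ}

lemma IsInColoring.trianglesEdgeDisjoint {k : ℕ} {f : G.Coloring (Fin k)} {g : V → Fin k}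
    (h : IsInColoring f g p) : G.TrianglesEdgeDisjoint := by
  have cyc : ∀ {a b c}, G.Adj a b → G.Adj a c → G.Adj b c → g b = f a →
      g a = f c ∧ f c ≠ g b := by
    intro a b c hab hac hbc hgb
    have := h.arc hac
    have := h.arc hbc
    have := f.valid hab
    have := f.valid hac
    have := f.valid hbc
    grind
  intro a b c c' hab hac hbc hac' hbc'
  rcases h.arc hab with ⟨h1, -⟩ | ⟨h1, -⟩
  · obtain ⟨h2, h3⟩ := cyc hab hac hbc h1
    obtain ⟨h4, -⟩ := cyc hab hac' hbc' h1
    exact h.unique_out hbc hbc' (h2.symm.trans h4) h3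
  · obtain ⟨h2, h3⟩ := cyc hab.symm hbc hac h1
    obtain ⟨h4, -⟩ := cyc hab.symm hbc' hac' h1
    exact h.unique_out hac hac' (h2.symm.trans h4) h3

lemma IsInColoring.isIndepSet {k : ℕ} {f : G.Coloring (Fin k)} {g : V → Fin k}
    (h : IsInColoring f g p) (A : Finset (Fin k)) : G.IsIndepSet {v | f v ∈ A ∧ g v ∉ A} := by
  intro u hu v hv _ huv
  rcases h.arc huv with h1 | h1
  · exact hv.2 (h1.1 ▸ hu.1)
  · exact hu.2 (h1.1 ▸ hv.1)

lemma card_filter_mem_notMem {k : ℕ} {a b : Fin k} (hab : a ≠ b) :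
    4 * {A : Finset (Fin k) | a ∈ A ∧ b ∉ A}.toFinset.card = 2 ^ k := by
  have h1 : {A : Finset (Fin k) | a ∈ A ∧ b ∉ A}.toFinset
      = Finset.Icc {a} (Finset.univ.erase b) := by
    ext A
    simp only [Set.mem_toFinset, Set.mem_ofPred_eq, Finset.mem_Icc,
      Finset.singleton_subset_iff, Finset.subset_erase, Finset.subset_univ, true_and]
  rw [h1, Finset.card_Icc_finset (by simpa using hab)]
  have hk : 2 ≤ k := by
    have := a.2; have := b.2; have : a.1 ≠ b.1 := fun e => hab (Fin.ext e)
    omega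
  obtain ⟨m, rfl⟩ := Nat.exists_eq_add_of_le hk
  simp only [Finset.mem_univ, Finset.card_erase_of_mem, Finset.card_univ, Fintype.card_fin,
    Finset.card_singleton]
  rw [show 2 + m - 1 - 1 = m by omega, pow_add]
  norm_num

lemma IsInColoring.card_lt_four_mul_indepNum [Nonempty V] {k : ℕ} {f : G.Coloring (Fin k)}
    {g : V → Fin k} (h : IsInColoring f g p) : Fintype.card V < 4 * G.indepNum := by
  classical
  by_contra! hcon
  have hle : ∀ A : Finset (Fin k), 4 * {v | f v ∈ A ∧ g v ∉ A}.toFinset.card ≤ Fintype.card V := by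
    intro A
    refine le_trans (Nat.mul_le_mul_left 4 ?_) hcon
    apply IsIndepSet.card_le_indepNum
    simpa using h.isIndepSet A
  have hlt : ∑ A : Finset (Fin k), 4 * {v | f v ∈ A ∧ g v ∉ A}.toFinset.card
      < ∑ _A : Finset (Fin k), Fintype.card V := by
    refine Finset.sum_lt_sum (fun A _ => hle A) ⟨∅, Finset.mem_univ _, ?_⟩
    simp [Fintype.card_pos]
  have heq : ∑ A : Finset (Fin k), 4 * {v | f v ∈ A ∧ g v ∉ A}.toFinset.card
      = ∑ v : V, 4 * {A : Finset (Fin k) | f v ∈ A ∧ g v ∉ A}.toFinset.card := by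
    simp only [Set.toFinset_ofPred, Finset.card_filter, ← Finset.mul_sum]
    rw [Finset.sum_comm]
  rw [heq, Finset.sum_congr rfl fun v _ => card_filter_mem_notMem (h.ne v).symm] at hlt
  simp [mul_comm] at hlt

lemma IsInColoring.colorable_clog {k : ℕ} {f : G.Coloring (Fin k)} {g : V → Fin k}
    (h : IsInColoring f g p) : G.Colorable (2 * Nat.clog 2 k) := by
  have hbit : ∀ v, ∃ b : Fin (Nat.clog 2 k), (f v).1.testBit b ≠ (g v).1.testBit b := by
    intro v
    by_contra! hcon
    refine h.ne v (Fin.ext (Nat.eq_of_testBit_eq fun i => ?_))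
    by_cases hi : i < Nat.clog 2 k
    · exact (hcon ⟨i, hi⟩).symm
    · have hlt : ∀ c : Fin k, c.1 < 2 ^ i := fun c =>
        c.2.trans_le ((Nat.le_pow_clog one_lt_two k).trans
          (Nat.pow_le_pow_right two_pos (not_lt.1 hi)))
      rw [Nat.testBit_lt_two_pow (hlt _), Nat.testBit_lt_two_pow (hlt _)]
  choose b hb using hbit
  let C : G.Coloring (Fin (Nat.clog 2 k) × Bool) := Coloring.mk (fun v => (b v, (f v).1.testBit (b v)))
    (by
      intro u v huv heq
      simp only [Prod.mk.injEq] at heq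
      obtain ⟨h1, h2⟩ := heq
      have hu := hb u
      have hv := hb v
      rcases h.arc huv with h3 | h3
      · rw [h3.1] at hv; rw [h1] at h2; exact hv h2.symm
      · rw [h3.1] at hu; rw [← h1] at h2; exact hu h2)
  simpa [mul_comm] using C.colorable

lemma two_mul_clog_le {q : ℕ} (hq : 4 ≤ q) :
    ((2 * Nat.clog 2 q : ℕ) : ℝ) ≤ 3 * Real.logb 2 q := by
  have hpow : ∀ m : ℕ, 2 ^ m ≤ q → (m : ℝ) ≤ Real.logb 2 q := by
    intro m hm
    rw [Real.le_logb_iff_rpow_le one_lt_two (by positivity), Real.rpow_natCast]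
    exact_mod_cast hm
  push_cast
  rcases le_or_gt (Nat.clog 2 q) 3 with hc | hc
  · have h2 := hpow 2 (by norm_num; omega)
    have : (Nat.clog 2 q : ℝ) ≤ 3 := by exact_mod_cast hc
    push_cast at h2
    linarith
  · have h1 := hpow (Nat.clog 2 q - 1) (Nat.pow_pred_clog_lt_self one_lt_two (by omega)).le
    have h3 : (4 : ℝ) ≤ Nat.clog 2 q := by exact_mod_cast hc
    rw [Nat.cast_sub (by omega)] at h1
    push_cast at h1
    linarith

lemma IsInColoring.exists_chromaticNumber_le (hp : 2 ≤ p) {f : G.Coloring (Fin (p + 2))}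
    {g : V → Fin (p + 2)} (h : IsInColoring f g p) :
    ∃ c : ℕ, G.chromaticNumber = (c : ℕ∞) ∧ (c : ℝ) ≤ 3 * Real.logb 2 ((p : ℝ) + 2) := by
  have hle := chromaticNumber_le_iff_colorable.2 h.colorable_clog
  obtain ⟨c, hc⟩ := ENat.ne_top_iff_exists.1 (ne_top_of_le_ne_top (ENat.natCast_ne_top _) hle)
  refine ⟨c, hc.symm, ?_⟩
  rw [← hc] at hle
  have h1 : (c : ℝ) ≤ ((2 * Nat.clog 2 (p + 2) : ℕ) : ℝ) := by exact_mod_cast hle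
  have h2 := two_mul_clog_le (show 4 ≤ p + 2 by omega)
  push_cast at h1 h2 ⊢
  linarith

lemma IsInColoring.colorable_three {f : G.Coloring (Fin 4)} {g : V → Fin 4}
    (h : IsInColoring f g p) : G.Colorable 3 := by
  let ψ : Fin 4 → Fin 4 → Fin 3 := fun i j =>
    if i.1 % 2 = j.1 % 2 then 2 else if i.1 % 2 = 0 then 0 else 1
  have hψ : ∀ i j k : Fin 4, i ≠ j → i ≠ k → j ≠ k → ψ i j ≠ ψ k i := by decide
  refine ⟨Coloring.mk (fun v => ψ (f v) (g v)) ?_⟩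
  intro u v huv
  have h1 := f.valid huv
  rcases h.arc huv with ⟨h2, h3⟩ | ⟨h2, h3⟩
  · rw [h2]; exact hψ _ _ _ (h.ne u).symm h1 h3
  · rw [h2]; exact (hψ _ _ _ (h.ne v).symm h1.symm h3).symm

lemma IsInColoring.exists_isAsteroidalTriple [Nonempty V] (hp : 3 ≤ p)
    {f : G.Coloring (Fin (p + 2))} {g : V → Fin (p + 2)} (h : IsInColoring f g p) :
    ∃ a b c : V, G.IsAsteroidalTriple a b c := by
  classical
  obtain ⟨m⟩ := ‹Nonempty V›
  obtain ⟨u, hu⟩ : ∃ u, u ∈ ({u ∈ G.neighborFinset m | f u = g m} : Finset V) := by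
    rw [← Finset.Nonempty, ← Finset.card_pos, h.card_in]; omega
  simp only [Finset.mem_filter, mem_neighborFinset] at hu
  obtain ⟨hmu, hfu⟩ := hu
  have hgm := h.ne m
  have hgu : g u ≠ f m := by
    have := h.arc hmu
    grind
  have pick : ∀ s : Finset (Fin (p + 2)), s.card ≤ 4 → ∃ c, c ∉ s := by
    intro s hs
    by_contra! hcon
    have : s = Finset.univ := by ext; simp [hcon]
    rw [this] at hs
    simp at hs
    omega
  obtain ⟨c, hc⟩ := pick {f m, g m, g u} (Finset.card_le_three.trans (by norm_num))
  obtain ⟨k, hk⟩ := pick {f m, g m, c} (Finset.card_le_three.trans (by norm_num))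
  obtain ⟨l, hl⟩ := pick {f m, g m, c, k} Finset.card_le_four
  simp only [Finset.mem_insert, Finset.mem_singleton, not_or] at hc hk hl
  obtain ⟨w, hmw, hfw, hgw⟩ := h.exists_out m k hk.1 hk.2.1
  obtain ⟨x, hmx, hfx, hgx⟩ := h.exists_out m l hl.1 hl.2.1
  obtain ⟨a, hua, hfa, hga⟩ := h.exists_out u c (hfu ▸ hc.2.1) hc.2.2
  obtain ⟨b, hwb, hfb, hgb⟩ := h.exists_out w c (hfw ▸ Ne.symm hk.2.2) (hgw ▸ hc.1)
  obtain ⟨d, hxd, hfd, hgd⟩ := h.exists_out x c (hfx ▸ Ne.symm hl.2.2.1) (hgx ▸ hc.1)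
  have hind : ∀ {s t}, f s = c → f t = c → ¬ G.Adj s t := fun hs ht hst =>
    f.valid hst (hs.trans ht.symm)
  have hav : ∀ {s t}, f s = c → f t ≠ c → g t ≠ c → f t ≠ g s → t ≠ s ∧ ¬ G.Adj s t := by
    intro s t hs h1 h2 h3
    refine ⟨fun e => h1 (e ▸ hs), fun hst => ?_⟩
    rcases h.arc hst with h4 | h4
    · exact h2 (h4.1.trans hs)
    · exact h3 h4.1.symm
  have hab : a ≠ b := by rintro rfl; grind
  have had : a ≠ d := by rintro rfl; grind
  have hbd : b ≠ d := by rintro rfl; grind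
  refine ⟨a, b, d, ⟨hab, had, hbd⟩, ⟨hind hfa hfb, hind hfa hfd, hind hfb hfd⟩, ?_, ?_, ?_⟩
  · refine HasPathAvoiding.of_walk
      (.cons hua.symm (.cons hmu.symm (.cons hmw (.cons hwb .nil)))) ?_
    simp only [Walk.support_cons, Walk.support_nil, List.mem_cons, List.not_mem_nil, or_false]
    rintro v (rfl | rfl | rfl | rfl | rfl)
    · exact ⟨had, hind hfd hfa⟩
    · exact hav hfd (by grind) (by grind) (by grind)
    · exact hav hfd (by grind) (by grind) (by grind)
    · exact hav hfd (by grind) (by grind) (by grind)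
    · exact ⟨hbd, hind hfd hfb⟩
  · refine HasPathAvoiding.of_walk
      (.cons hua.symm (.cons hmu.symm (.cons hmx (.cons hxd .nil)))) ?_
    simp only [Walk.support_cons, Walk.support_nil, List.mem_cons, List.not_mem_nil, or_false]
    rintro v (rfl | rfl | rfl | rfl | rfl)
    · exact ⟨hab, hind hfb hfa⟩
    · exact hav hfb (by grind) (by grind) (by grind)
    · exact hav hfb (by grind) (by grind) (by grind)
    · exact hav hfb (by grind) (by grind) (by grind)
    · exact ⟨hbd.symm, hind hfb hfd⟩
  · refine HasPathAvoiding.of_walk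
      (.cons hwb.symm (.cons hmw.symm (.cons hmx (.cons hxd .nil)))) ?_
    simp only [Walk.support_cons, Walk.support_nil, List.mem_cons, List.not_mem_nil, or_false]
    rintro v (rfl | rfl | rfl | rfl | rfl)
    · exact ⟨hab.symm, hind hfa hfb⟩
    · exact hav hfa (by grind) (by grind) (by grind)
    · exact hav hfa (by grind) (by grind) (by grind)
    · exact hav hfa (by grind) (by grind) (by grind)
    · exact ⟨had.symm, hind hfa hfd⟩

end InColoring

section Count

variable [Fintype V] [DecidableRel G.Adj] {p : ℕ}

lemma IsInColoring.card_filter_relation [DecidableEq V] {k : ℕ} {f : G.Coloring (Fin k)}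
    {g : V → Fin k} (h : IsInColoring f g p) {U : Finset V}
    (hU : ∀ u ∈ U, ∀ v, G.Adj u v → v ∈ U) {i j : Fin k} (hij : i ≠ j) :
    p * {v ∈ U | f v = i ∧ g v = j}.card + {v ∈ U | f v = j ∧ g v = i}.card
      = {v ∈ U | f v = j}.card := by
  set S := {v ∈ U | f v = i ∧ g v = j} with hS
  set T := {v ∈ U | f v = j} with hT
  have key := Finset.sum_card_bipartiteAbove_eq_sum_card_bipartiteBelow (s := S) (t := T) G.Adj
  have h1 : ∀ v ∈ S, (T.bipartiteAbove G.Adj v).card = p := by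
    intro v hv
    simp only [hS, Finset.mem_filter] at hv
    rw [← h.card_in v]
    congr 1
    ext u
    simp only [hT, Finset.mem_bipartiteAbove, Finset.mem_filter, mem_neighborFinset]
    constructor
    · rintro ⟨⟨_, h2⟩, h3⟩; exact ⟨h3, h2.trans hv.2.2.symm⟩
    · rintro ⟨h2, h3⟩; exact ⟨⟨hU v hv.1 u h2, h3.trans hv.2.2⟩, h2⟩
  have h2 : ∀ u ∈ T, (S.bipartiteBelow G.Adj u).card = if g u ≠ i then 1 else 0 := by
    intro u hu
    simp only [hT, Finset.mem_filter] at hu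
    split_ifs with hgu
    · obtain ⟨w, hw, hfw, hgw⟩ := h.exists_out u i (hu.2 ▸ hij) (Ne.symm hgu)
      rw [Finset.card_eq_one]
      refine ⟨w, ?_⟩
      ext v
      simp only [hS, Finset.mem_bipartiteBelow, Finset.mem_filter, Finset.mem_singleton]
      constructor
      · rintro ⟨⟨_, h3, _⟩, h4⟩
        exact h.unique_out h4.symm hw (h3.trans hfw.symm) (h3 ▸ Ne.symm hgu)
      · rintro rfl
        exact ⟨⟨hU u hu.1 v hw, hfw, hgw.trans hu.2⟩, hw.symm⟩
    · rw [Finset.card_eq_zero, Finset.eq_empty_iff_forall_notMem]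
      intro v hv
      simp only [hS, Finset.mem_bipartiteBelow, Finset.mem_filter] at hv
      have := h.arc hv.2
      grind
  rw [Finset.sum_congr rfl h1, Finset.sum_congr rfl h2, Finset.sum_const, smul_eq_mul,
    ← Finset.card_filter, mul_comm] at key
  rw [key, ← Finset.card_filter_add_card_filter_not (s := T) (fun u => g u ≠ i)]
  congr 2
  ext u
  simp [hT, and_assoc]

/-- In a union of connected components, the number `p * #U` of edges is divisible by three. -/
lemma IsInColoring.three_dvd_mul_card [DecidableEq V] (hp : 2 ≤ p) {f : G.Coloring (Fin (p + 2))}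
    {g : V → Fin (p + 2)} (h : IsInColoring f g p) {U : Finset V}
    (hU : ∀ u ∈ U, ∀ v, G.Adj u v → v ∈ U) : 3 ∣ p * U.card := by
  let x : Fin (p + 2) → Fin (p + 2) → ℤ := fun i j => ({v ∈ U | f v = i ∧ g v = j}.card : ℤ)
  let a : Fin (p + 2) → ℤ := fun i => ({v ∈ U | f v = i}.card : ℤ)
  have hrel : ∀ i j, i ≠ j → (p : ℤ) * x i j + x j i = a j := fun i j hij => by
    have := h.card_filter_relation hU hij
    simp only [x, a]
    exact_mod_cast this
  have hx : ∀ i j, i ≠ j → ((p : ℤ) ^ 2 - 1) * x i j = p * a j - a i := fun i j hij => by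
    linear_combination (p : ℤ) * hrel i j hij - hrel j i hij.symm
  have hsum : ∀ i, ∑ j ∈ Finset.univ.erase i, x i j = a i := by
    intro i
    have := Finset.card_eq_sum_card_fiberwise (s := {v ∈ U | f v = i})
      (t := Finset.univ.erase i) (f := g) (by
        intro v hv
        simp only [Finset.coe_filter, Set.mem_ofPred_eq] at hv
        simpa [← hv.2] using h.ne v)
    simp only [a, x, this, Finset.filter_filter]
    push_cast
    rfl
  have htot : ∑ i, a i = U.card := by
    have := Finset.card_eq_sum_card_fiberwise (s := U) (t := Finset.univ) (f := f) (by simp)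
    simp only [a, this]
    push_cast
    rfl
  have hp0 : (p : ℤ) ≠ 0 := by positivity
  have ha : ∀ i, ((p : ℤ) + 2) * a i = U.card := by
    intro i
    have h1 : ∑ j ∈ Finset.univ.erase i, ((p : ℤ) ^ 2 - 1) * x i j
        = ∑ j ∈ Finset.univ.erase i, (p * a j - a i) :=
      Finset.sum_congr rfl fun j hj => hx i j (Finset.ne_of_mem_erase hj).symm
    rw [← Finset.mul_sum, hsum, Finset.sum_sub_distrib, ← Finset.mul_sum] at h1
    have h2 := Finset.add_sum_erase Finset.univ a (Finset.mem_univ i)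
    simp only [Finset.sum_const, Finset.mem_univ, Finset.card_erase_of_mem, Finset.card_univ,
      Fintype.card_fin, nsmul_eq_mul] at h1
    rw [htot] at h2
    rw [show p + 2 - 1 = p + 1 by omega] at h1
    push_cast at h1
    refine mul_left_cancel₀ hp0 ?_
    linear_combination h1 + (p : ℤ) * h2
  have h01 : (0 : Fin (p + 2)) ≠ 1 := by simp
  have hx01 := hx 0 1 h01
  have heq : a 1 = a 0 := by
    refine mul_left_cancel₀ (by positivity : (p : ℤ) + 2 ≠ 0) ?_
    rw [ha, ha]
  have hxa : ((p : ℤ) + 1) * x 0 1 = a 0 := by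
    have : (p : ℤ) - 1 ≠ 0 := by omega
    refine mul_left_cancel₀ this ?_
    rw [heq] at hx01
    linear_combination hx01
  have hfin : ((p * U.card : ℕ) : ℤ) = (p * (p + 1) * (p + 2) : ℤ) * x 0 1 := by
    push_cast
    rw [← ha 0, ← hxa]
    ring
  have h3 : (3 : ℤ) ∣ p * (p + 1) * (p + 2) := by
    have : (p : ℤ) % 3 = 0 ∨ (p : ℤ) % 3 = 1 ∨ (p : ℤ) % 3 = 2 := by omega
    rcases this with h | h | h
    · exact ((Int.dvd_of_emod_eq_zero h).mul_right _).mul_right _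
    · exact Dvd.dvd.mul_left (by omega) _
    · exact (Dvd.dvd.mul_left (by omega) _).mul_right _
  have : (3 : ℤ) ∣ ((p * U.card : ℕ) : ℤ) := hfin ▸ h3.mul_right _
  exact_mod_cast this

end Count

/-- A transition system pairs up the darts leaving each vertex. -/
structure IsTransition (θ : Equiv.Perm G.Dart) : Prop where
  apply_apply : ∀ d, θ (θ d) = d
  ne : ∀ d, θ d ≠ d
  fst : ∀ d, (θ d).fst = d.fst

/-- The reversal of darts, as a permutation. -/
def dartSymm (G : SimpleGraph V) : Equiv.Perm G.Dart := Dart.symm_involutive.toPerm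

@[simp] lemma dartSymm_apply (d : G.Dart) : G.dartSymm d = d.symm := rfl

/-- The dart following a given dart on its trail in a transition system. -/
def nextDart (θ : Equiv.Perm G.Dart) : Equiv.Perm G.Dart := θ * G.dartSymm

lemma nextDart_apply (θ : Equiv.Perm G.Dart) (d : G.Dart) : nextDart θ d = θ d.symm := rfl

/-- Two darts lie on the same trail, possibly with opposite directions. -/
def SameTrail (θ : Equiv.Perm G.Dart) (d d' : G.Dart) : Prop :=
  (nextDart θ).SameCycle d d' ∨ (nextDart θ).SameCycle d d'.symm

namespace IsTransition

variable {θ θ' : Equiv.Perm G.Dart}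

lemma semiconjBy (h : IsTransition θ) :
    SemiconjBy G.dartSymm (nextDart θ) (nextDart θ)⁻¹ := by
  have hρ : G.dartSymm⁻¹ = G.dartSymm := rfl
  have hθ : θ⁻¹ = θ := by
    ext1 d
    rw [Equiv.Perm.inv_eq_iff_eq, h.apply_apply]
  simp only [SemiconjBy, nextDart, mul_inv_rev, hρ, hθ]
  rw [mul_assoc]

lemma symm_zpow (h : IsTransition θ) (k : ℤ) (d : G.Dart) :
    ((nextDart θ ^ k) d).symm = (nextDart θ ^ (-k)) d.symm := by
  have := h.semiconjBy.zpow_right k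
  rw [inv_zpow, ← zpow_neg] at this
  exact congrArg (fun e : Equiv.Perm G.Dart => e d) this

lemma sameCycle_symm (h : IsTransition θ) {a b : G.Dart} (hab : (nextDart θ).SameCycle a b) :
    (nextDart θ).SameCycle a.symm b.symm := by
  obtain ⟨k, rfl⟩ := hab
  exact ⟨-k, (h.symm_zpow k a).symm⟩

lemma not_sameCycle_symm (h : IsTransition θ) (d : G.Dart) :
    ¬ (nextDart θ).SameCycle d d.symm := by
  rintro ⟨k, hk⟩
  obtain ⟨m, rfl | rfl⟩ := Int.even_or_odd' k
  · set y := (nextDart θ ^ m) d with hy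
    have h1 : (nextDart θ ^ m) y = (nextDart θ ^ m) y.symm := by
      rw [hy, h.symm_zpow, ← Equiv.Perm.mul_apply, ← Equiv.Perm.mul_apply, ← zpow_add,
        ← zpow_add, ← two_mul, hk]
      simp
    exact y.symm_ne ((nextDart θ ^ m).injective h1).symm
  · set y := (nextDart θ ^ m) d with hy
    have h1 : (nextDart θ ^ m) (nextDart θ y) = (nextDart θ ^ m) y.symm := by
      rw [hy, h.symm_zpow, ← Equiv.Perm.mul_apply, ← Equiv.Perm.mul_apply, ← Equiv.Perm.mul_apply,
        ← zpow_add_one, ← zpow_add, ← zpow_add]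
      rw [show m + 1 + m = 2 * m + 1 by ring, hk]
      simp
    have h2 := (nextDart θ ^ m).injective h1
    exact h.ne _ h2

lemma sameTrail_refl (θ : Equiv.Perm G.Dart) (d : G.Dart) : SameTrail θ d d :=
  Or.inl (Equiv.Perm.SameCycle.refl _ _)

lemma sameTrail_symm_right {d d' : G.Dart} : SameTrail θ d d'.symm ↔ SameTrail θ d d' := by
  simp [SameTrail, or_comm]

lemma sameTrail_dart_symm (θ : Equiv.Perm G.Dart) (d : G.Dart) : SameTrail θ d d.symm :=
  sameTrail_symm_right.2 (sameTrail_refl θ d)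

lemma sameTrail_symm (h : IsTransition θ) {d d' : G.Dart} (hd : SameTrail θ d d') :
    SameTrail θ d' d := by
  rcases hd with hd | hd
  · exact Or.inl hd.symm
  · right
    simpa using (h.sameCycle_symm hd).symm

lemma sameTrail_trans (h : IsTransition θ) {d d' d'' : G.Dart} (hd : SameTrail θ d d')
    (hd' : SameTrail θ d' d'') : SameTrail θ d d'' := by
  rcases hd with hd | hd <;> rcases hd' with hd' | hd'
  · exact Or.inl (hd.trans hd')
  · exact Or.inr (hd.trans hd')
  · exact Or.inr (hd.trans (h.sameCycle_symm hd'))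
  · refine Or.inl (hd.trans ?_)
    simpa using h.sameCycle_symm hd'

lemma sameTrail_apply (h : IsTransition θ) (d : G.Dart) : SameTrail θ d (θ d) := by
  refine h.sameTrail_trans (sameTrail_dart_symm θ d) (Or.inl ⟨1, ?_⟩)
  simp [nextDart_apply]

/-- If only the transitions at `x` and at `x'` are changed, and these are on different trails,
then the two ends of the transition at `x` remain connected. -/
lemma sameCycle_of_eq_off [Finite V] (h : IsTransition θ) {x x' : G.Dart}
    (hoff : ∀ d, d ≠ x → d ≠ θ x → d ≠ x' → d ≠ θ x' → θ' d = θ d) (hx : ¬ SameTrail θ x x') :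
    (nextDart θ').SameCycle (θ x) x.symm := by
  classical
  have : Finite G.Dart := by
    have := Fintype.ofFinite V
    infer_instance
  have hstep : (nextDart θ).SameCycle (θ x) x.symm := by
    refine Equiv.Perm.SameCycle.symm ⟨1, ?_⟩
    simp [nextDart_apply]
  obtain ⟨i, -, hi⟩ := hstep.exists_pow_eq'
  have hex : ∃ n : ℕ, (nextDart θ ^ n) (θ x) = x.symm := ⟨i, hi⟩
  have hmin := fun m => Nat.find_min hex (m := m)
  have hn := Nat.find_spec hex
  set n := Nat.find hex
  have hsx : ∀ d, (nextDart θ).SameCycle (θ x) d.symm → SameTrail θ x d := fun d hd =>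
    h.sameTrail_trans (h.sameTrail_apply x) (Or.inr hd)
  have hpow : ∀ k ≤ n, (nextDart θ' ^ k) (θ x) = (nextDart θ ^ k) (θ x) := by
    intro k
    induction k with
    | zero => simp
    | succ k ih =>
      intro hk
      rw [pow_succ', pow_succ', Equiv.Perm.mul_apply, Equiv.Perm.mul_apply, ih (by omega),
        nextDart_apply, nextDart_apply]
      have hsc : ∀ d, ((nextDart θ ^ k) (θ x)).symm = d → (nextDart θ).SameCycle (θ x) d.symm := by
        rintro d rfl
        exact ⟨k, by simp⟩
      refine hoff _ ?_ ?_ ?_ ?_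
      · intro he
        exact hmin k (by omega) (by simpa using congrArg Dart.symm he)
      · intro he
        exact h.not_sameCycle_symm _ (hsc _ he)
      · intro he
        exact hx (hsx _ (hsc _ he))
      · intro he
        refine hx (h.sameTrail_trans (hsx _ (hsc _ he)) (h.sameTrail_symm (h.sameTrail_apply x')))
  exact ⟨n, by rw [zpow_natCast, hpow n le_rfl, hn]⟩

/-- Changing transitions at two darts on different trails only merges trails. -/
lemma sameTrail_mono [Finite V] (h : IsTransition θ) (h' : IsTransition θ') {x x' : G.Dart}
    (hoff : ∀ d, d ≠ x → d ≠ θ x → d ≠ x' → d ≠ θ x' → θ' d = θ d) (hx : ¬ SameTrail θ x x')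
    {d d' : G.Dart} (hd : SameTrail θ d d') : SameTrail θ' d d' := by
  have : Finite G.Dart := by
    classical
    have := Fintype.ofFinite V
    infer_instance
  have hx1 : SameTrail θ' x (θ x) :=
    h'.sameTrail_symm (Or.inr (h.sameCycle_of_eq_off hoff hx))
  have hx2 : SameTrail θ' x' (θ x') :=
    h'.sameTrail_symm (Or.inr (h.sameCycle_of_eq_off (fun d h1 h2 h3 h4 => hoff d h3 h4 h1 h2)
      (fun hc => hx (h.sameTrail_symm hc))))
  have hθ : ∀ d, SameTrail θ' d (θ d) := by
    intro d
    by_cases h1 : d = x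
    · exact h1 ▸ hx1
    by_cases h2 : d = θ x
    · rw [h2, h.apply_apply]; exact h'.sameTrail_symm hx1
    by_cases h3 : d = x'
    · exact h3 ▸ hx2
    by_cases h4 : d = θ x'
    · rw [h4, h.apply_apply]; exact h'.sameTrail_symm hx2
    rw [← hoff d h1 h2 h3 h4]
    exact h'.sameTrail_apply d
  have hpow : ∀ (n : ℕ) d, SameTrail θ' d ((nextDart θ ^ n) d) := by
    intro n
    induction n with
    | zero => intro d; exact sameTrail_refl θ' d
    | succ n ih =>
      intro d
      rw [pow_succ', Equiv.Perm.mul_apply, nextDart_apply]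
      exact h'.sameTrail_trans (ih d) (h'.sameTrail_trans (sameTrail_dart_symm θ' _) (hθ _))
  have hcyc : ∀ {a b}, (nextDart θ).SameCycle a b → SameTrail θ' a b := by
    intro a b hab
    obtain ⟨n, -, rfl⟩ := hab.exists_pow_eq'
    exact hpow n a
  rcases hd with hd | hd
  · exact hcyc hd
  · exact sameTrail_symm_right.1 (hcyc hd)

/-- Exchange of partners: `x` is paired with `x'`, and `θ x` with `θ x'`. -/
lemma exists_exchange (h : IsTransition θ) {x x' : G.Dart} (hfst : x.fst = x'.fst)
    (hne : x' ≠ x) (hne' : x' ≠ θ x) :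
    ∃ θ' : Equiv.Perm G.Dart, IsTransition θ' ∧ θ' x = x' ∧ θ' x' = x ∧ θ' (θ x) = θ x' ∧
      θ' (θ x') = θ x ∧ ∀ d, d ≠ x → d ≠ θ x → d ≠ x' → d ≠ θ x' → θ' d = θ d := by
  classical
  have h1 := h.ne x
  have h2 := h.ne x'
  have h3 : θ x' ≠ x := fun e => hne' (by rw [← e, h.apply_apply])
  have h4 : θ x' ≠ θ x := fun e => hne (θ.injective e)
  set s := Equiv.swap (θ x) x' with hs
  have sx : s x = x := Equiv.swap_apply_of_ne_of_ne h1.symm hne.symm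
  have sx' : s x' = θ x := Equiv.swap_apply_right _ _
  have sy : s (θ x) = x' := Equiv.swap_apply_left _ _
  have sy' : s (θ x') = θ x' := Equiv.swap_apply_of_ne_of_ne h4 h2
  have sfst : ∀ d, (s d).fst = d.fst := by
    intro d
    by_cases hd : d = θ x
    · rw [hd, sy, h.fst, hfst]
    by_cases hd' : d = x'
    · rw [hd', sx', h.fst, hfst]
    rw [hs, Equiv.swap_apply_of_ne_of_ne hd hd']
  have ss : ∀ d, s (s d) = d := Equiv.swap_apply_self _ _
  refine ⟨s * θ * s, ⟨fun d => ?_, fun d => ?_, fun d => ?_⟩, ?_, ?_, ?_, ?_, ?_⟩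
  · simp only [Equiv.Perm.mul_apply, ss, h.apply_apply]
  · simp only [Equiv.Perm.mul_apply]
    intro e
    refine h.ne (s d) (s.injective ?_)
    rw [e, ss]
  · simp only [Equiv.Perm.mul_apply, sfst, h.fst]
  · simp only [Equiv.Perm.mul_apply, sx, sy]
  · simp only [Equiv.Perm.mul_apply, sx', h.apply_apply, sx]
  · simp only [Equiv.Perm.mul_apply, sy, sy']
  · simp only [Equiv.Perm.mul_apply, sy', h.apply_apply, sx']
  · intro d hd1 hd2 hd3 hd4
    simp only [Equiv.Perm.mul_apply]
    rw [hs, Equiv.swap_apply_of_ne_of_ne hd2 hd3, Equiv.swap_apply_of_ne_of_ne]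
    · exact fun e => hd1 (θ.injective e)
    · exact fun e => hd4 (by rw [← e, h.apply_apply])

end IsTransition

/-- Two darts from the same vertex that span a triangle. -/
def SpanTriangle (x y : G.Dart) : Prop := x.fst = y.fst ∧ G.Adj x.snd y.snd

lemma SpanTriangle.symm {x y : G.Dart} (h : SpanTriangle x y) : SpanTriangle y x :=
  ⟨h.1.symm, h.2.symm⟩

lemma TrianglesEdgeDisjoint.spanTriangle_unique (hG : G.TrianglesEdgeDisjoint) {x y z : G.Dart}
    (hy : SpanTriangle x y) (hz : SpanTriangle x z) : y = z := by
  have h1 : G.Adj x.fst y.snd := hy.1 ▸ y.adj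
  have h2 : G.Adj x.fst z.snd := hz.1 ▸ z.adj
  have := hG x.adj h1 hy.2 h2 hz.2
  exact Dart.ext _ _ (Prod.ext (hy.1.symm.trans hz.1) this)

/-- No transition is part of a triangle. -/
def TriangleFreeTransition (θ : Equiv.Perm G.Dart) : Prop := ∀ d, ¬ SpanTriangle d (θ d)

section Finite

variable [Fintype V] [DecidableRel G.Adj] {p : ℕ}

lemma card_fst_fiber {m : ℕ} (hreg : G.IsRegularOfDegree m) (v : V)
    [DecidablePred fun d : G.Dart => d.fst = v] :
    ({d | d.fst = v} : Finset G.Dart).card = m := by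
  classical
  rw [← hreg v, ← dart_fst_fiber_card_eq_degree]
  congr

lemma exists_isTransition (hreg : G.IsRegularOfDegree (2 * p)) :
    ∃ θ : Equiv.Perm G.Dart, IsTransition θ := by
  classical
  have hcard : ∀ v : V, Fintype.card {d : G.Dart // d.fst = v} = Fintype.card (Fin p × Bool) := by
    intro v
    rw [Fintype.card_subtype, card_fst_fiber hreg]
    simp [mul_comm]
  let e : ∀ v : V, {d : G.Dart // d.fst = v} ≃ Fin p × Bool := fun v =>
    Fintype.equivOfCardEq (hcard v)
  let τ : ∀ v : V, Equiv.Perm {d : G.Dart // d.fst = v} := fun v =>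
    (e v).symm.permCongr (Equiv.prodCongr (Equiv.refl _) Equiv.boolNot)
  have hτ : ∀ v x, τ v (τ v x) = x := by
    intro v x
    simp [τ, Prod.map]
  have hτ' : ∀ v x, τ v x ≠ x := by
    intro v x hx
    have := congrArg (fun y => (e v y).2) hx
    simp [τ] at this
  let E := Equiv.sigmaFiberEquiv (fun d : G.Dart => d.fst)
  have hE : ∀ s, (E s).fst = s.1 := fun s => s.2.2
  refine ⟨E.permCongr (Equiv.Perm.sigmaCongrRight τ), fun d => ?_, fun d => ?_, fun d => ?_⟩
  · obtain ⟨s, rfl⟩ := E.surjective d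
    simp [hτ]
  · obtain ⟨s, rfl⟩ := E.surjective d
    obtain ⟨v, x⟩ := s
    simp only [Equiv.permCongr_apply, Equiv.symm_apply_apply]
    intro he
    have h2 : (⟨v, τ v x⟩ : Σ v : V, {d : G.Dart // d.fst = v}) = ⟨v, x⟩ := E.injective he
    simp only [Sigma.mk.injEq, heq_eq_eq, true_and] at h2
    exact hτ' v x h2
  · obtain ⟨s, rfl⟩ := E.surjective d
    simp [hE]

lemma exists_triangleFreeTransition (hp : 2 ≤ p) (hreg : G.IsRegularOfDegree (2 * p))
    (hG : G.TrianglesEdgeDisjoint) :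
    ∃ θ : Equiv.Perm G.Dart, IsTransition θ ∧ TriangleFreeTransition θ := by
  classical
  let S : Finset (Equiv.Perm G.Dart) := {θ | IsTransition θ}
  obtain ⟨θ₀, hθ₀⟩ := exists_isTransition hreg
  obtain ⟨θ, hθ, hmin⟩ := S.exists_min_image
    (fun θ => ({d | SpanTriangle d (θ d)} : Finset G.Dart).card) ⟨θ₀, by simpa [S] using hθ₀⟩
  have h : IsTransition θ := by simpa [S] using hθ
  refine ⟨θ, h, fun x hx => ?_⟩
  obtain ⟨x', hx'1, hx'2⟩ : ∃ x' ∈ ({d | d.fst = x.fst} : Finset G.Dart), x' ∉ ({x, θ x} : Finset _) := by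
    apply Finset.exists_mem_notMem_of_card_lt_card
    rw [card_fst_fiber hreg]
    exact lt_of_le_of_lt Finset.card_le_two (by omega)
  simp only [Finset.mem_filter, Finset.mem_univ, true_and, Finset.mem_insert,
    Finset.mem_singleton, not_or] at hx'1 hx'2
  obtain ⟨θ', h', h1, h2, h3, h4, h5⟩ := h.exists_exchange hx'1.symm hx'2.1 hx'2.2
  have hx'3 : θ x' ≠ x := fun e => hx'2.2 (by rw [← e, h.apply_apply])
  have hlt : ({d | SpanTriangle d (θ' d)} : Finset G.Dart).card
      < ({d | SpanTriangle d (θ d)} : Finset G.Dart).card := by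
    apply Finset.card_lt_card
    have n1 : ¬ SpanTriangle x x' := fun hc => hx'2.2 (hG.spanTriangle_unique hc hx)
    have n2 : ¬ SpanTriangle (θ x) (θ x') := fun hc =>
      hx'3 (hG.spanTriangle_unique hc hx.symm)
    refine (Finset.ssubset_iff_of_subset ?_).2 ⟨x, by simpa using hx, by simpa [h1] using n1⟩
    intro d hd
    simp only [Finset.mem_filter, Finset.mem_univ, true_and] at hd ⊢
    by_cases e1 : d = x
    · rw [e1, h1] at hd; exact absurd hd n1
    by_cases e2 : d = θ x
    · rw [e2, h3] at hd; exact absurd hd n2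
    by_cases e3 : d = x'
    · rw [e3, h2] at hd; exact absurd hd.symm n1
    by_cases e4 : d = θ x'
    · rw [e4, h4] at hd; exact absurd hd.symm n2
    rwa [h5 d e1 e2 e3 e4] at hd
  exact absurd hlt (not_lt.2 (hmin θ' (by simpa [S] using h')))

/-- There is a transition system without transitions in triangles in which any two darts from the
same vertex lie on the same trail. -/
theorem exists_connected_triangleFreeTransition (hp : 2 ≤ p)
    (hreg : G.IsRegularOfDegree (2 * p)) (hG : G.TrianglesEdgeDisjoint) :
    ∃ θ : Equiv.Perm G.Dart, IsTransition θ ∧ TriangleFreeTransition θ ∧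
      ∀ x x' : G.Dart, x.fst = x'.fst → SameTrail θ x x' := by
  classical
  let S : Finset (Equiv.Perm G.Dart) := {θ | IsTransition θ ∧ TriangleFreeTransition θ}
  obtain ⟨θ₀, hθ₀⟩ := exists_triangleFreeTransition hp hreg hG
  obtain ⟨θ, hθ, hmax⟩ := S.exists_max_image
    (fun θ => ({d | SameTrail θ d.1 d.2} : Finset (G.Dart × G.Dart)).card)
    ⟨θ₀, by simpa [S] using hθ₀⟩
  have h : IsTransition θ ∧ TriangleFreeTransition θ := by simpa [S] using hθ
  obtain ⟨h, hfree⟩ := h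
  have key : ∀ x x' : G.Dart, x.fst = x'.fst → ¬ SameTrail θ x x' →
      ¬ SpanTriangle x x' → ¬ SpanTriangle (θ x) (θ x') → False := by
    intro x x' hfst hx n1 n2
    have hne : x' ≠ x := fun e => hx (e ▸ IsTransition.sameTrail_refl θ x)
    have hne' : x' ≠ θ x := fun e => hx (e ▸ h.sameTrail_apply x)
    obtain ⟨θ', h', h1, h2, h3, h4, h5⟩ := h.exists_exchange hfst hne hne'
    have hfree' : TriangleFreeTransition θ' := by
      intro d hd
      by_cases e1 : d = x
      · rw [e1, h1] at hd; exact absurd hd n1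
      by_cases e2 : d = θ x
      · rw [e2, h3] at hd; exact absurd hd n2
      by_cases e3 : d = x'
      · rw [e3, h2] at hd; exact absurd hd.symm n1
      by_cases e4 : d = θ x'
      · rw [e4, h4] at hd; exact absurd hd.symm n2
      rw [h5 d e1 e2 e3 e4] at hd
      exact hfree d hd
    have hlt : ({d | SameTrail θ d.1 d.2} : Finset (G.Dart × G.Dart)).card
        < ({d | SameTrail θ' d.1 d.2} : Finset (G.Dart × G.Dart)).card := by
      apply Finset.card_lt_card
      refine (Finset.ssubset_iff_of_subset ?_).2 ⟨(x, x'), ?_, by simpa using hx⟩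
      · intro d hd
        simp only [Finset.mem_filter, Finset.mem_univ, true_and] at hd ⊢
        exact h.sameTrail_mono h' h5 hx hd
      · simpa [h1] using h'.sameTrail_apply x
    exact absurd hlt (not_lt.2 (hmax θ' (by simpa [S] using ⟨h', hfree'⟩)))
  refine ⟨θ, h, hfree, fun x x' hfst => ?_⟩
  by_contra hx
  have hx2 : ¬ SameTrail θ x (θ x') := fun hc =>
    hx (h.sameTrail_trans hc (h.sameTrail_symm (h.sameTrail_apply x')))
  have hne' : x' ≠ θ x := fun e => hx (e ▸ h.sameTrail_apply x)
  have hne : x' ≠ x := fun e => hx (e ▸ IsTransition.sameTrail_refl θ x)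
  by_cases hbad : SpanTriangle x x' ∨ SpanTriangle (θ x) (θ x')
  · refine key x (θ x') (hfst.trans (h.fst x').symm) hx2 (fun hc => ?_) (fun hc => ?_)
    · rcases hbad with hb | hb
      · exact h.ne x' (hG.spanTriangle_unique hc hb)
      · exact h.ne x (hG.spanTriangle_unique hb.symm hc.symm)
    · rw [h.apply_apply] at hc
      rcases hbad with hb | hb
      · exact h.ne x (hG.spanTriangle_unique hc.symm hb.symm)
      · exact h.ne x' (hG.spanTriangle_unique hb hc)
  · push Not at hbad
    exact key x x' hfst hx hbad.1 hbad.2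

end Finite

end SimpleGraph

/-- A permutation all of whose cycles have length divisible by `m` admits a labelling modulo `m`
that increases by one along each cycle. -/
lemma Equiv.Perm.exists_zmod_labelling {α : Type*} [Fintype α] [DecidableEq α]
    (φ : Equiv.Perm α) [DecidableRel φ.SameCycle] {m : ℕ}
    (h : ∀ a, m ∣ (Finset.univ.filter fun b => φ.SameCycle a b).card) :
    ∃ c : α → ZMod m, ∀ a, c (φ a) = c a + 1 := by
  let r : α → α := fun a => (Quotient.mk (SameCycle.setoid φ) a).out
  have hr : ∀ a, φ.SameCycle (r a) a := fun a => Quotient.mk_out (s := SameCycle.setoid φ) a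
  have hr' : ∀ a, r (φ a) = r a := fun a =>
    congrArg Quotient.out (Quotient.sound (s := SameCycle.setoid φ)
      (sameCycle_apply_left.2 (SameCycle.refl φ a)))
  choose k hk using hr
  refine ⟨fun a => (k a : ZMod m), fun a => ?_⟩
  have h1 := hk (φ a)
  rw [hr'] at h1
  have h2 : (φ ^ (k (φ a) - (k a + 1))) (r a) = r a := by
    rw [sub_eq_neg_add, zpow_add, mul_apply, h1, zpow_neg, inv_eq_iff_eq, zpow_add, mul_apply,
      zpow_one]
    conv_lhs => rw [← hk a]
    rw [← mul_apply, ← mul_apply, ← zpow_one_add, ← zpow_add_one, add_comm]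
  have hcyc : φ.IsCycleOn ((Finset.univ.filter fun b => φ.SameCycle (r a) b : Finset α) : Set α) := by
    refine ⟨⟨?_, φ.injective.injOn, ?_⟩, ?_⟩
    · intro x hx
      simpa using hx
    · intro x hx
      exact ⟨φ⁻¹ x, by simpa using hx, by simp⟩
    · intro x hx y hy
      simp only [Finset.coe_filter, Finset.mem_univ, true_and, Set.mem_ofPred_eq] at hx hy
      exact hx.symm.trans hy
  have h3 := (hcyc.zpow_apply_eq (by simp [SameCycle.refl])).1 h2
  have h4 : ((k (φ a) - (k a + 1) : ℤ) : ZMod m) = 0 :=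
    (ZMod.intCast_zmod_eq_zero_iff_dvd _ _).2 ((Int.natCast_dvd_natCast.2 (h (r a))).trans h3)
  push_cast at h4
  exact sub_eq_zero.1 h4

namespace SimpleGraph

variable {V : Type*} {G : SimpleGraph V}

variable {θ : Equiv.Perm G.Dart}

/-- One direction can be chosen for each trail. -/
lemma IsTransition.exists_direction (h : IsTransition θ) :
    ∃ P : G.Dart → Prop, (∀ d, P (nextDart θ d) ↔ P d) ∧ ∀ d, P d.symm ↔ ¬ P d := by
  let s : Setoid G.Dart :=
    ⟨SameTrail θ, fun d => IsTransition.sameTrail_refl θ d, fun hd => h.sameTrail_symm hd,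
      fun hd hd' => h.sameTrail_trans hd hd'⟩
  let r : G.Dart → G.Dart := fun d => (Quotient.mk s d).out
  have hr : ∀ d, SameTrail θ (r d) d := fun d => Quotient.mk_out (s := s) d
  have hr1 : ∀ d, r d.symm = r d := fun d => congrArg Quotient.out
    (Quotient.sound (s := s) (h.sameTrail_symm (IsTransition.sameTrail_dart_symm θ d)))
  have hr2 : ∀ d, r (nextDart θ d) = r d := fun d => congrArg Quotient.out
    (Quotient.sound (s := s) (Or.inl (Equiv.Perm.sameCycle_apply_left.2
      (Equiv.Perm.SameCycle.refl _ d))))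
  refine ⟨fun d => (nextDart θ).SameCycle (r d) d, fun d => ?_, fun d => ?_⟩
  · simp only [hr2, Equiv.Perm.sameCycle_apply_right]
  · simp only [hr1]
    constructor
    · intro h1 h2
      exact h.not_sameCycle_symm d (h2.symm.trans h1)
    · intro h1
      exact (hr d).resolve_left h1

/-- The path on four vertices formed by three consecutive darts of a transition system. -/
lemma exists_copy_pathGraph (h : IsTransition θ) (hfree : TriangleFreeTransition θ) (d : G.Dart) :
    ∃ S : G.Subgraph, Nonempty (S.coe ≃g pathGraph 4) ∧ ∀ e, e ∈ S.edgeSet ↔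
      e = d.edge ∨ e = (nextDart θ d).edge ∨ e = (nextDart θ (nextDart θ d)).edge := by
  have hfst : ∀ d, (nextDart θ d).fst = d.snd := fun d => h.fst d.symm
  have hback : ∀ d, (nextDart θ d).snd ≠ d.fst := by
    intro d hd
    refine h.ne d.symm (Dart.ext _ _ (Prod.ext (h.fst _) ?_))
    exact hd
  set d₁ := nextDart θ d with hd₁
  set d₂ := nextDart θ d₁ with hd₂
  have h01 : G.Adj d.fst d.snd := d.adj
  have h12 : G.Adj d.snd d₁.snd := hfst d ▸ d₁.adj
  have h23 : G.Adj d₁.snd d₂.snd := hfst d₁ ▸ d₂.adj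
  have h02 : d.fst ≠ d₁.snd := (hback d).symm
  have h13 : d.snd ≠ d₂.snd := by
    have := hback d₁
    rw [hfst] at this
    exact this.symm
  have h03 : d.fst ≠ d₂.snd := by
    intro he
    refine hfree d.symm ⟨(h.fst _).symm, ?_⟩
    change G.Adj d.fst d₁.snd
    rw [he]
    exact h23.symm
  let φ : Fin 4 → V := ![d.fst, d.snd, d₁.snd, d₂.snd]
  have hφ : Function.Injective φ := by
    have := h01.ne
    have := h12.ne
    have := h23.ne
    intro i j hij
    fin_cases i <;> fin_cases j <;> simp_all [φ]
  have hedge : ∀ e : Sym2 (Fin 4), e ∈ (pathGraph 4).edgeSet ↔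
      e = s(0, 1) ∨ e = s(1, 2) ∨ e = s(2, 3) := by
    intro e
    induction e with
    | h i j =>
      simp only [mem_edgeSet, pathGraph_adj]
      revert i j
      decide
  have hmap : ∀ i j, (pathGraph 4).Adj i j → G.Adj (φ i) (φ j) := by
    intro i j hij
    have := (hedge s(i, j)).1 hij
    rcases this with he | he | he <;> rcases Sym2.eq_iff.1 he with ⟨rfl, rfl⟩ | ⟨rfl, rfl⟩
    exacts [h01, h01.symm, h12, h12.symm, h23, h23.symm]
  let C : Copy (pathGraph 4) G := ⟨⟨φ, fun {i j} => hmap i j⟩, hφ⟩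
  refine ⟨C.toSubgraph, ⟨C.isoToSubgraph.symm⟩, fun e => ?_⟩
  have e0 : d.edge = s(φ 0, φ 1) := rfl
  have e1 : d₁.edge = s(φ 1, φ 2) := by
    change s(d₁.fst, d₁.snd) = s(d.snd, d₁.snd)
    rw [hfst]
  have e2 : d₂.edge = s(φ 2, φ 3) := by
    change s(d₂.fst, d₂.snd) = s(d₁.snd, d₂.snd)
    rw [hfst]
  rw [Copy.toSubgraph, Subgraph.edgeSet_map, e0, e1, e2]
  simp only [Subgraph.edgeSet_top, Set.mem_image, hedge]
  constructor
  · rintro ⟨x, rfl | rfl | rfl, rfl⟩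
    exacts [Or.inl rfl, Or.inr (Or.inl rfl), Or.inr (Or.inr rfl)]
  · rintro (rfl | rfl | rfl)
    exacts [⟨s(0, 1), Or.inl rfl, rfl⟩, ⟨s(1, 2), Or.inr (Or.inl rfl), rfl⟩,
      ⟨s(2, 3), Or.inr (Or.inr rfl), rfl⟩]

section Finite

variable [Fintype V] [DecidableRel G.Adj] {p : ℕ}

lemma IsTransition.exists_card_sameCycle [DecidableEq V]
    [DecidableRel (nextDart θ).SameCycle] (h : IsTransition θ)
    (hreg : G.IsRegularOfDegree (2 * p))
    (hconn : ∀ x x' : G.Dart, x.fst = x'.fst → SameTrail θ x x') (d : G.Dart) :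
    ∃ U : Finset V, (∀ u ∈ U, ∀ v, G.Adj u v → v ∈ U) ∧
      (Finset.univ.filter fun e => (nextDart θ).SameCycle d e).card = p * U.card := by
  classical
  let U : Finset V := {v | ∃ e : G.Dart, SameTrail θ d e ∧ e.fst = v}
  have hU : ∀ v, v ∈ U ↔ ∃ e : G.Dart, SameTrail θ d e ∧ e.fst = v := fun v => by simp [U]
  refine ⟨U, ?_, ?_⟩
  · intro u hu v huv
    obtain ⟨e, he, rfl⟩ := (hU u).1 hu
    let e' : G.Dart := ⟨(e.fst, v), huv⟩
    exact (hU v).2 ⟨e'.symm, IsTransition.sameTrail_symm_right.2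
      (h.sameTrail_trans he (hconn e e' rfl)), rfl⟩
  · let A : Finset G.Dart := {e | (nextDart θ).SameCycle d e}
    let B : Finset G.Dart := {e | (nextDart θ).SameCycle d e.symm}
    have hAB : A ∪ B = ({e | e.fst ∈ U} : Finset G.Dart) := by
      ext e
      simp only [A, B, Finset.mem_union, Finset.mem_filter, Finset.mem_univ, true_and, hU]
      constructor
      · intro he
        exact ⟨e, he, rfl⟩
      · rintro ⟨e', he', hfst⟩
        exact h.sameTrail_trans he' (hconn e' e hfst)
    have hdisj : Disjoint A B := by
      rw [Finset.disjoint_left]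
      intro e he he'
      simp only [A, B, Finset.mem_filter, Finset.mem_univ, true_and] at he he'
      exact h.not_sameCycle_symm e (he.symm.trans he')
    have hcard : B.card = A.card := by
      refine Finset.card_bij' (fun e _ => e.symm) (fun e _ => e.symm) ?_ ?_ ?_ ?_ <;>
        simp [A, B]
    have htot : ({e | e.fst ∈ U} : Finset G.Dart).card = U.card * (2 * p) := by
      rw [Finset.card_eq_sum_card_fiberwise (f := fun e : G.Dart => e.fst) (t := U)
        (by intro e he; simpa using he), ← smul_eq_mul, ← Finset.sum_const]
      refine Finset.sum_congr rfl fun v hv => ?_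
      rw [← card_fst_fiber hreg v, Finset.filter_filter]
      congr 1
      ext e
      simp only [Finset.mem_filter, Finset.mem_univ, true_and]
      exact ⟨fun he => he.2, fun he => ⟨he ▸ hv, he⟩⟩
    have h1 := Finset.card_union_of_disjoint hdisj
    rw [hAB, htot, hcard] at h1
    change A.card = _
    nlinarith

/-- A `2p`-regular graph with `p ≥ 2` in which no two triangles share an edge has a decomposition
into paths on four vertices, if each union of components has a number of edges divisible by
three. -/
theorem TrianglesEdgeDisjoint.hasDecomposition_pathGraph (hG : G.TrianglesEdgeDisjoint)
    (hp : 2 ≤ p) (hreg : G.IsRegularOfDegree (2 * p))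
    (hdvd : ∀ U : Finset V, (∀ u ∈ U, ∀ v, G.Adj u v → v ∈ U) → 3 ∣ p * U.card) :
    G.HasDecomposition (pathGraph 4) := by
  classical
  obtain ⟨θ, h, hfree, hconn⟩ := exists_connected_triangleFreeTransition hp hreg hG
  obtain ⟨c, hc⟩ := (nextDart θ).exists_zmod_labelling (m := 3) (by
    intro d
    obtain ⟨U, hU, hcard⟩ := h.exists_card_sameCycle hreg hconn d
    rw [hcard]
    exact hdvd U hU)
  obtain ⟨P, hP, hPs⟩ := h.exists_direction
  choose S hS hSe using exists_copy_pathGraph h hfree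
  set φ := nextDart θ with hφ
  have hcP : ∀ d : G.Dart, ∃ d', d'.edge = d.edge ∧ P d' := by
    intro d
    by_cases hd : P d
    · exact ⟨d, rfl, hd⟩
    · exact ⟨d.symm, d.edge_symm, (hPs d).2 hd⟩
  have huniq : ∀ d d' : G.Dart, d.edge = d'.edge → P d → P d' → d = d' := by
    intro d d' he hd hd'
    rcases (dart_edge_eq_iff d d').1 he with h1 | h1
    · exact h1
    · rw [h1] at hd
      exact absurd hd' ((hPs d').1 hd)
  have hcs : ∀ d, c (φ.symm d) = c d - 1 := by
    intro d
    rw [eq_sub_iff_add_eq, ← hc]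
    simp
  have hPsy : ∀ d, P (φ.symm d) ↔ P d := by
    intro d
    rw [← hP]
    simp
  refine ⟨{T | ∃ d, P d ∧ c d = 0 ∧ T = S d}, ?_, ?_⟩
  · rintro T ⟨d, -, -, rfl⟩
    exact hS d
  · intro e he
    obtain ⟨d, rfl, hd⟩ : ∃ d : G.Dart, d.edge = e ∧ P d := by
      induction e with
      | h u v => exact hcP ⟨(u, v), he⟩
    have hback : ∀ d', P d' → c d' = 0 → d.edge ∈ (S d').edgeSet →
        (c d = 0 ∧ d' = d) ∨ (c d = 1 ∧ d' = φ.symm d) ∨ (c d = 2 ∧ d' = φ.symm (φ.symm d)) := by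
      intro d' hd' hc' hmem
      rcases (hSe d' _).1 hmem with h1 | h1 | h1
      · have := huniq _ _ h1 hd hd'
        exact Or.inl ⟨this ▸ hc', this.symm⟩
      · have := huniq _ _ h1 hd ((hP _).2 hd')
        refine Or.inr (Or.inl ⟨?_, ?_⟩)
        · rw [this, hc, hc', zero_add]
        · rw [this]; simp
      · have := huniq _ _ h1 hd ((hP _).2 ((hP _).2 hd'))
        refine Or.inr (Or.inr ⟨?_, ?_⟩)
        · rw [this, hc, hc, hc']; rfl
        · rw [this]; simp
    have hex : ∃ d', P d' ∧ c d' = 0 ∧ d.edge ∈ (S d').edgeSet := by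
      have h3 : ∀ x : ZMod 3, x = 0 ∨ x = 1 ∨ x = 2 := by decide
      rcases h3 (c d) with h0 | h1 | h2
      · exact ⟨d, hd, h0, (hSe _ _).2 (Or.inl rfl)⟩
      · exact ⟨φ.symm d, (hPsy _).2 hd, by rw [hcs, h1]; rfl,
          (hSe _ _).2 (Or.inr (Or.inl (by simp)))⟩
      · exact ⟨φ.symm (φ.symm d), (hPsy _).2 ((hPsy _).2 hd), by rw [hcs, hcs, h2]; rfl,
          (hSe _ _).2 (Or.inr (Or.inr (by simp)))⟩
    obtain ⟨d₀, hd₀, hc₀, hm₀⟩ := hex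
    refine ⟨S d₀, ⟨⟨d₀, hd₀, hc₀, rfl⟩, hm₀⟩, ?_⟩
    rintro T ⟨⟨d', hd', hc', rfl⟩, hm'⟩
    have h1 := hback d₀ hd₀ hc₀ hm₀
    have h2 := hback d' hd' hc' hm'
    have n01 : (0 : ZMod 3) ≠ 1 := by decide
    have n02 : (0 : ZMod 3) ≠ 2 := by decide
    have n12 : (1 : ZMod 3) ≠ 2 := by decide
    congr 1
    grind

end Finite

end SimpleGraph

theorem mainTheorem8 {V : Type*} [Fintype V] [Nonempty V] (G : SimpleGraph V)
    [DecidableRel G.Adj] (p : ℕ) (hp : 2 ≤ p) (hreg : G.IsRegularOfDegree (2 * p))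
    (hstar : G.StarColorable (p + 2)) :
    (SimpleGraph.diamondGraph.Free G ∧ (SimpleGraph.completeGraph (Fin 4)).Free G) ∧
    (Fintype.card V : ℝ) / 4 < (G.indepNum : ℝ) ∧
    (∃ c : ℕ, G.chromaticNumber = (c : ℕ∞) ∧ (c : ℝ) ≤ 3 * Real.logb 2 ((p : ℝ) + 2)) ∧
    G.HasDecomposition (SimpleGraph.pathGraph 4) ∧
    ((¬ ∃ a b c : V, G.IsAsteroidalTriple a b c) → G.Colorable 3) := by
  classical
  obtain ⟨f, hf⟩ := hstar
  obtain ⟨g, h⟩ := hf.exists_inColoring hp hreg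
  have hT := h.trianglesEdgeDisjoint
  refine ⟨⟨hT.diamond_free, fun hK => hT.diamond_free
    (SimpleGraph.diamond_isContained_completeGraph.trans hK)⟩, ?_,
    h.exists_chromaticNumber_le hp,
    hT.hasDecomposition_pathGraph hp hreg fun U hU => h.three_dvd_mul_card hp hU, fun hAT => ?_⟩
  · have h1 : (Fintype.card V : ℝ) < 4 * G.indepNum := by
      exact_mod_cast h.card_lt_four_mul_indepNum
    linarith
  · rcases hp.eq_or_lt with rfl | hp3
    · exact h.colorable_three
    · exact absurd (h.exists_isAsteroidalTriple hp3) hAT
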